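/- \textbf{Theorem.} Let $M_1,\dots,M_d\ge 0$ be integers, let $\mathcal M=\{\mathbf n\in\mathbb Z^d: 0\le n_i\le M_i\}$, $n=|\mathcal M|$, and let $\Phi$ be the oversampled discrete Fourier transform, with entries $\Phi(\mathbf w,\mathbf n)=e^{-2\pi i\,\mathbf n\cdot\mathbf w}$, $\mathbf n\in\mathcal M$, $w_i\in\{0,\frac1{2M_i+1},\dots,\frac{2M_i}{2M_i+1}\}$. Let $\ell\ge 2$ and let $\mu_1,\dots,\mu_\ell$ be (random or deterministic) phase masks on $\mathcal M$, i.e. $|\mu_j(\mathbf n)|=1$ almost surely. Suppose that for at least one index $j_0$ the random variables $\mu_{j_0}(\mathbf n)$, $\mathbf n\in\mathcal M$, are independent and continuously distributed (no atoms) on the unit circle, and that $\mu_{j_0}$ is independent of $\mu_j$ for each $j\ne j_0$. Let the stacked matrix $$A^*=c\begin{bmatrix}\Phi\,\mathrm{diag}\{\mu_1\}\\ \vdots\\ \Phi\,\mathrm{diag}\{\mu_\ell\}\end{bmatrix}\in\mathbb C^{N\times n}$$ be isometric ($AA^*=I$), where $c\in\mathbb C$ is a constant. Let $x_0\in\mathbb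 C^n=\mathbb C^{\mathcal M}$ be a deterministic object of rank $\ge 2$, i.e. the convex hull of $\{\mathbf n\in\mathcal M: x_0(\mathbf n)\neq0\}$ in $\mathbb R^d$ has dimension at least two. Put $$B=A\,\mathrm{diag}\{\omega_0\},\qquad \omega_0=\frac{A^*x_0}{|A^*x_0|}$$ (componentwise, with $\omega_0(j)=1$ where $(A^*x_0)(j)=0$), and let $\lambda_2$ be the second largest singular value, counted with multiplicity, of the real matrix $\begin{bmatrix}\Re B\\ \Im B\end{bmatrix}\in\mathbb R^{2n\times N}$. Then with probability one the following hold. For $u\in\mathbb C^n$, $$\|\Im(B^*u)\|=1\ \text{ and }\ \|u\|=1\quad\Longleftrightarrow\quad u=\pm\, i x_0/\|x_0\|,$$ and $$\lambda_2=\max_{0\ne u\in\mathbb C^n,\ u\perp i x_0}\|u\|^{-1}\|\Im(B^*u)\|<1,$$ where $\perp$ refers to the real inner product $\Re(u^*v)$. -/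

import Mathlib

open MeasureTheory ProbabilityTheory
open scoped Matrix

noncomputable section

namespace CodedDiffraction

/-- The object grid `{n ∈ ℤ^d : 0 ≤ n_i ≤ M_i}`. -/
abbrev ObjGrid {d : ℕ} (M : Fin d → ℕ) : Type := ∀ i, Fin (M i + 1)

/-- Index set of the sampling grid: `k` stands for the frequency `w_i = k_i / (2 M_i + 1)`,
`0 ≤ k_i ≤ 2 M_i`. -/
abbrev FreqGrid {d : ℕ} (M : Fin d → ℕ) : Type := ∀ i, Fin (2 * M i + 1)

/-- The (unnormalized) oversampled discrete Fourier transform, with entries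
`exp (-2π i n · w)`, `w_i = k_i / (2 M_i + 1)`. -/
def oversampledDFT {d : ℕ} (M : Fin d → ℕ) : Matrix (FreqGrid M) (ObjGrid M) ℂ :=
  Matrix.of fun k n =>
    Complex.exp (-(2 * (Real.pi : ℂ) * Complex.I *
      ∑ i, ((n i : ℕ) : ℂ) * (((k i : ℕ) : ℂ) / ((2 * M i + 1 : ℕ) : ℂ))))

/-- The propagation matrix `A^*`: the blocks `c Φ diag(μ_j)`, `j = 1, …, ℓ`, stacked. -/
def propagation {d ℓ : ℕ} (M : Fin d → ℕ) (c : ℂ) (μ : Fin ℓ → ObjGrid M → ℂ) :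
    Matrix (Fin ℓ × FreqGrid M) (ObjGrid M) ℂ :=
  Matrix.of fun p n => c * (oversampledDFT M * Matrix.diagonal (μ p.1)) p.2 n

/-- The phase vector `y / |y|`, with the phase set to `1` where `y` vanishes. -/
def phase {ι : Type*} (y : ι → ℂ) : ι → ℂ :=
  fun j => if y j = 0 then 1 else y j / (‖y j‖ : ℂ)

/-- `B = A diag(ω₀)`, `ω₀ = A^* x₀ / |A^* x₀|`, as a function of the matrix `A^*` and of `x₀`. -/
def matB {ι κ : Type*} [Fintype κ] [Fintype ι] [DecidableEq ι]
    (Astar : Matrix ι κ ℂ) (x₀ : EuclideanSpace ℂ κ) : Matrix κ ι ℂ :=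
  Astarᴴ * Matrix.diagonal (phase (Astar *ᵥ x₀.ofLp))

/-- `Im (B^* u)`, a vector of the Euclidean space `ℝ^N`. -/
def imBstar {ι κ : Type*} [Fintype κ]
    (B : Matrix κ ι ℂ) (u : EuclideanSpace ℂ κ) : EuclideanSpace ℝ ι :=
  WithLp.toLp 2 fun j => ((Bᴴ *ᵥ u.ofLp) j).im

/-- The real form of `B`: the real matrix `[Re B; Im B]` with `2n` rows and `N` columns. -/
def realForm {ι κ : Type*} (B : Matrix κ ι ℂ) : Matrix (κ ⊕ κ) ι ℝ :=
  Matrix.fromRows (B.map Complex.re) (B.map Complex.im)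

/-- `λ₂`, the second largest singular value (with multiplicity) of the real form of `B`;
Mathlib's decreasing sequence of singular values is indexed from `0`. -/
def lambdaTwo {ι κ : Type*} [Fintype κ] [DecidableEq κ] [Fintype ι] [DecidableEq ι]
    (B : Matrix κ ι ℂ) : ℝ :=
  (Matrix.toEuclideanLin (realForm B)).singularValues 1

/-- The rank of an object: the dimension of the convex hull of its support in `ℝ^d`. -/
def objectRank {d : ℕ} {M : Fin d → ℕ} (x : EuclideanSpace ℂ (ObjGrid M)) : ℕ :=
  Module.finrank ℝ (vectorSpan ℝ
    (convexHull ℝ ((fun (n : ObjGrid M) (i : Fin d) => ((n i : ℕ) : ℝ)) '' {n | x n ≠ 0})))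

end CodedDiffraction

end

namespace CodedDiffraction

/-! Since `A^*` is isometric and `ω₀` unimodular, `‖Im (B^* u)‖ = ‖u‖` forces `Re (B^* u) = 0`, so
`conj (A^* x₀) * A^* u` is purely imaginary at every sampled frequency. The oversampling turns this
into an identity between correlation coefficients, and the mixed radix index carries it to one
variable: an equality of two products of Laurent polynomials for each mask
(`phaseSol_of_re_eq_zero`).

Comparing top coefficients for the random mask and one other mask shows that both have the same
phase defect at four extreme points. Almost surely this is impossible unless the extreme points of
the solution are those of the object, possibly exchanged (`ae_defect_ne`, `extreme_mem`).
Subtracting the multiple of `x₀` that cancels `u` at its top point leaves only the exchanged case,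
and a third support point, supplied by rank at least two, rules that out. Hence `u` is an imaginary
multiple of `x₀` (`eq_smul_of_phaseSol`).

The real form of `B` is then a contraction whose adjoint preserves norms only on the real line
through `i x₀`. So the singular value 1 is simple, and the next one is the norm of the adjoint on
the orthogonal complement (`isGreatest_singularValues_one`). -/

/-! ### Genericity of the random mask. -/

/-- An atomless random variable almost surely differs from any independent one. -/
lemma ae_ne_of_indepFun {Ω : Type*} [MeasurableSpace Ω] {P : Measure Ω} [IsProbabilityMeasure P]
    {X Y : Ω → ℂ} (hX : Measurable X) (hY : Measurable Y) (hXY : IndepFun X Y P)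
    (hcont : ∀ z, P {ω | X ω = z} = 0) : ∀ᵐ ω ∂P, X ω ≠ Y ω := by
  have hmap := (indepFun_iff_map_prod_eq_prod_map_map hX.aemeasurable hY.aemeasurable).1 hXY
  have hdiag : MeasurableSet {p : ℂ × ℂ | p.1 = p.2} := measurableSet_diagonal
  have : IsProbabilityMeasure (P.map X) := Measure.isProbabilityMeasure_map hX.aemeasurable
  have : IsProbabilityMeasure (P.map Y) := Measure.isProbabilityMeasure_map hY.aemeasurable
  have h0 : (P.map fun ω => (X ω, Y ω)) {p : ℂ × ℂ | p.1 = p.2} = 0 := by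
    -- Fubini: each horizontal slice of the diagonal is a single point, hence null for the atomless
    -- law.
    rw [hmap, Measure.prod_apply_symm hdiag]
    have : ∀ y, (P.map X) ((fun x => (x, y)) ⁻¹' {p : ℂ × ℂ | p.1 = p.2}) = 0 := by
      intro y
      have hpre : (fun x : ℂ => (x, y)) ⁻¹' {p : ℂ × ℂ | p.1 = p.2} = {y} := by
        ext x; simp
      rw [hpre, Measure.map_apply hX (measurableSet_singleton y)]
      exact hcont y
    simp_rw [this, lintegral_zero]
  rw [Measure.map_apply (hX.prodMk hY) hdiag] at h0
  rw [ae_iff]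
  simpa using h0

/-- The phase defect `m(e) m(e') / (m(p) m(q))` of a unimodular mask. -/
def defect {κ : Type*} (m : κ → ℂ) (e e' p q : κ) : ℂ :=
  m e * m e' * star (m p) * star (m q)

lemma measurable_defect {κ : Type*} (e e' p q : κ) :
    Measurable fun m : κ → ℂ => defect m e e' p q := by
  unfold defect
  have hs : Measurable fun z : ℂ => star z := continuous_star.measurable
  exact (((measurable_pi_apply e).mul (measurable_pi_apply e')).mul
    (hs.comp (measurable_pi_apply p))).mul (hs.comp (measurable_pi_apply q))

/-- For unimodular entries the equation can be solved for `m e`, and the solution involves only the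
other entries, which are independent of `m e`. Coincidences among `e'`, `p`, `q` do no harm. -/
lemma defect_atomless {Ω κ : Type*} [MeasurableSpace Ω] {P : Measure Ω} [IsProbabilityMeasure P]
    {m : Ω → κ → ℂ} (hm : ∀ n, Measurable fun ω => m ω n)
    (hunit : ∀ n, ∀ᵐ ω ∂P, ‖m ω n‖ = 1) (hind : iIndepFun (fun n ω => m ω n) P)
    (hcont : ∀ n z, P {ω | m ω n = z} = 0) {e e' p q : κ} (he' : e ≠ e') (hp : e ≠ p)
    (hq : e ≠ q) (z : ℂ) : P {ω | defect (m ω) e e' p q = z} = 0 := by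
  classical
  let Y : Ω → ℂ := fun ω => z * star (m ω e') * m ω p * m ω q
  have hs : Measurable fun z : ℂ => star z := continuous_star.measurable
  have hfin := hind.indepFun_finset {e} {e', p, q} (by simp [he', hp, hq]) hm
  have hXY : IndepFun (fun ω => m ω e) Y P := by
    have hφ : Measurable fun f : ({e} : Finset κ) → ℂ => f ⟨e, by simp⟩ := measurable_pi_apply _
    have hψ : Measurable fun f : ({e', p, q} : Finset κ) → ℂ =>
        z * star (f ⟨e', by simp⟩) * f ⟨p, by simp⟩ * f ⟨q, by simp⟩ :=
      ((measurable_const.mul (hs.comp (measurable_pi_apply _))).mul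
        (measurable_pi_apply _)).mul (measurable_pi_apply _)
    exact hfin.comp hφ hψ
  have hY : Measurable Y := ((measurable_const.mul (hs.comp (hm e'))).mul (hm p)).mul (hm q)
  have hne := ae_ne_of_indepFun (hm e) hY hXY (hcont e)
  have hae : ∀ᵐ ω ∂P, defect (m ω) e e' p q ≠ z := by
    filter_upwards [hne, hunit e', hunit p, hunit q] with ω h h1 h2 h3 hz
    apply h
    have key : ∀ a : ℂ, ‖a‖ = 1 → a * star a = 1 := fun a ha => by
      rw [Complex.star_def, Complex.mul_conj, Complex.normSq_eq_norm_sq, ha]; simp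
    have k1 := key _ h1
    have k2 := key _ h2
    have k3 := key _ h3
    simp only [Y, ← hz, defect]
    calc m ω e = m ω e * (m ω e' * star (m ω e')) * (m ω p * star (m ω p)) *
          (m ω q * star (m ω q)) := by rw [k1, k2, k3]; ring
      _ = _ := by ring
  rw [ae_iff] at hae
  simpa using hae

/-- Independent masks, one of which has independent atomless entries, almost surely have different
phase defects. -/
lemma ae_defect_ne {Ω κ : Type*} [Finite κ] [MeasurableSpace Ω] {P : Measure Ω}
    [IsProbabilityMeasure P] {m m' : Ω → κ → ℂ} (hm : ∀ n, Measurable fun ω => m ω n)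
    (hm' : ∀ n, Measurable fun ω => m' ω n)
    (hunit : ∀ n, ∀ᵐ ω ∂P, ‖m ω n‖ = 1) (hind : iIndepFun (fun n ω => m ω n) P)
    (hcont : ∀ n z, P {ω | m ω n = z} = 0) (hmm' : IndepFun m m' P) :
    ∀ᵐ ω ∂P, ∀ e e' p q : κ, e ≠ e' → e ≠ p → e ≠ q →
      defect (m ω) e e' p q ≠ defect (m' ω) e e' p q := by
  simp only [ae_all_iff]
  intro e e' p q he' hp hq
  have hd := measurable_defect e e' p q
  exact ae_ne_of_indepFun (hd.comp (measurable_pi_iff.2 hm)) (hd.comp (measurable_pi_iff.2 hm'))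
    (hmm'.comp hd hd) (defect_atomless hm hunit hind hcont he' hp hq)

/-! ### Uniqueness by extreme coefficients of Laurent polynomials. -/

section Uniqueness

lemma ne_zero_of_norm_eq_one {κ : Type*} {m : κ → ℂ} (hm : ∀ n, ‖m n‖ = 1) (n : κ) : m n ≠ 0 := by
  rw [← norm_pos_iff, hm]; exact one_pos

variable {κ : Type*} [Fintype κ] {θ : κ → ℤ}

/-- The coefficient at `t` of the product of `∑ a(n) z^{-θ(n)}` and `∑ b(p) z^{θ(p)}`. -/
def corr (θ : κ → ℤ) (a b : κ → ℂ) (t : ℤ) : ℂ :=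
  ∑ n, ∑ p, if θ p - θ n = t then a n * b p else 0

/-- On the supports, `θ p - θ n` can reach its upper bound only at `(n₀, p₀)`, so the top
coefficient is a single product. -/
lemma corr_top (hθ : Function.Injective θ) {a b : κ → ℂ} {n₀ p₀ : κ}
    (ha : ∀ n, a n ≠ 0 → θ n₀ ≤ θ n) (hb : ∀ p, b p ≠ 0 → θ p ≤ θ p₀) :
    corr θ a b (θ p₀ - θ n₀) = a n₀ * b p₀ := by
  unfold corr
  rw [Finset.sum_eq_single n₀, Finset.sum_eq_single p₀]
  · simp
  · intro p _ hp
    rw [if_neg fun h => hp (hθ (by linarith))]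
  · simp
  · intro n _ hn
    refine Finset.sum_eq_zero fun p _ => ?_
    split_ifs with h
    · by_contra h0
      have h1 := ha n (left_ne_zero_of_mul h0)
      have h2 := hb p (right_ne_zero_of_mul h0)
      exact hn (hθ (by linarith))
    · rfl
  · simp

lemma le_of_corr_ne_zero {a b : κ → ℂ} {n₀ p₀ : κ} (ha : ∀ n, a n ≠ 0 → θ n₀ ≤ θ n)
    (hb : ∀ p, b p ≠ 0 → θ p ≤ θ p₀) {t : ℤ} (ht : corr θ a b t ≠ 0) : t ≤ θ p₀ - θ n₀ := by
  obtain ⟨n, -, hn⟩ := Finset.exists_ne_zero_of_sum_ne_zero ht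
  obtain ⟨p, -, hp⟩ := Finset.exists_ne_zero_of_sum_ne_zero hn
  obtain ⟨h, h0⟩ := ite_ne_right_iff.1 hp
  have h1 := ha n (left_ne_zero_of_mul h0)
  have h2 := hb p (right_ne_zero_of_mul h0)
  linarith

lemma corr_sub_smul_left (a a' b : κ → ℂ) (r : ℂ) (t : ℤ) :
    corr θ (fun n => a n - r * a' n) b t = corr θ a b t - r * corr θ a' b t := by
  simp only [corr, Finset.mul_sum, ← Finset.sum_sub_distrib]
  refine Finset.sum_congr rfl fun n _ => Finset.sum_congr rfl fun p _ => ?_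
  split_ifs <;> ring

lemma corr_sub_smul_right (a b b' : κ → ℂ) (r : ℂ) (t : ℤ) :
    corr θ a (fun p => b p - r * b' p) t = corr θ a b t - r * corr θ a b' t := by
  simp only [corr, Finset.mul_sum, ← Finset.sum_sub_distrib]
  refine Finset.sum_congr rfl fun n _ => Finset.sum_congr rfl fun p _ => ?_
  split_ifs <;> ring

/-- The pair `(v, w)` solves the phase equations of the object `x` under the mask `m`; for
`w = star v` these say that `conj (F (m x)) * F (m v)` is real, `F` being the Fourier transform. -/
def PhaseSol (θ : κ → ℤ) (m x v w : κ → ℂ) : Prop :=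
  ∀ t, corr θ (fun n => star (m n) * star (x n)) (fun p => m p * v p) t =
    corr θ (fun n => star (m n) * w n) (fun p => m p * x p) t

/-- The pair `(x, star x)` is itself a solution. For `r` not imaginary the subtraction destroys `w =
-star v`; this is why `v` and `w` are kept independent. -/
lemma PhaseSol.sub_smul {m x v w : κ → ℂ} (h : PhaseSol θ m x v w) (r : ℂ) :
    PhaseSol θ m x (fun n => v n - r * x n) (fun n => w n - r * star (x n)) := by
  intro t
  have e1 : (fun p => m p * (v p - r * x p)) = fun p => m p * v p - r * (m p * x p) := by
    ext p; ring
  have e2 : (fun n => star (m n) * (w n - r * star (x n))) =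
      fun n => star (m n) * w n - r * (star (m n) * star (x n)) := by
    ext n; ring
  rw [e1, e2, corr_sub_smul_left, corr_sub_smul_right, h t]

lemma exists_max_support {v : κ → ℂ} (hv : v ≠ 0) (θ : κ → ℤ) :
    ∃ g, v g ≠ 0 ∧ ∀ n, v n ≠ 0 → θ n ≤ θ g := by
  classical
  obtain ⟨n, hn⟩ := Function.ne_iff.1 hv
  obtain ⟨g, hg, hmax⟩ := Finset.exists_max_image (Finset.univ.filter fun n => v n ≠ 0) θ
    ⟨n, by simpa using hn⟩
  exact ⟨g, by simpa using hg, fun k hk => hmax k (by simpa using hk)⟩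

lemma exists_min_support {v : κ → ℂ} (hv : v ≠ 0) (θ : κ → ℤ) :
    ∃ g, v g ≠ 0 ∧ ∀ n, v n ≠ 0 → θ g ≤ θ n := by
  obtain ⟨g, hg, h⟩ := exists_max_support hv fun n => -θ n
  exact ⟨g, hg, fun n hn => neg_le_neg_iff.1 (h n hn)⟩

variable {m m' x v w : κ → ℂ} {sp sm gp gm : κ}

/-- Laurent polynomials have no zero divisors, seen here on the top coefficient. -/
lemma PhaseSol.ne_zero_iff (hθ : Function.Injective θ) (hm : ∀ n, ‖m n‖ = 1) (hx : x ≠ 0)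
    (h : PhaseSol θ m x v w) : v ≠ 0 ↔ w ≠ 0 := by
  have hm0 := ne_zero_of_norm_eq_one hm
  obtain ⟨sp, hsp0, hsp⟩ := exists_max_support hx θ
  obtain ⟨sm, hsm0, hsm⟩ := exists_min_support hx θ
  constructor
  · rintro hv rfl
    obtain ⟨g, hg0, hg⟩ := exists_max_support hv θ
    have ht := h (θ g - θ sm)
    rw [corr_top hθ (by simpa [hm0] using hsm) (by simpa [hm0] using hg)] at ht
    simp [corr, hm0, hg0, hsm0] at ht
  · rintro hw rfl
    obtain ⟨g, hg0, hg⟩ := exists_min_support hw θ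
    have ht := h (θ sp - θ g)
    rw [corr_top (a := fun n => star (m n) * w n) hθ (by simpa [hm0] using hg)
      (by simpa [hm0] using hsp)] at ht
    simp [corr, hm0, hg0, hsp0] at ht

/-- Both top coefficients are nonzero, so the two degrees agree and the coefficients can be equated.
Unimodularity collects all mask factors in the defect; the rest does not depend on the mask. -/
lemma PhaseSol.leading (hθ : Function.Injective θ) (hm : ∀ n, ‖m n‖ = 1)
    (h : PhaseSol θ m x v w) (hsp0 : x sp ≠ 0) (hsp : ∀ n, x n ≠ 0 → θ n ≤ θ sp)
    (hsm0 : x sm ≠ 0) (hsm : ∀ n, x n ≠ 0 → θ sm ≤ θ n)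
    (hgp0 : v gp ≠ 0) (hgp : ∀ n, v n ≠ 0 → θ n ≤ θ gp)
    (hgm0 : w gm ≠ 0) (hgm : ∀ n, w n ≠ 0 → θ gm ≤ θ n) :
    defect m sp sm gp gm * (w gm * x sp) = star (x sm) * v gp := by
  have hm0 := ne_zero_of_norm_eq_one hm
  have l1 : ∀ n, star (m n) * star (x n) ≠ 0 → θ sm ≤ θ n := by simpa [hm0] using hsm
  have l2 : ∀ p, m p * v p ≠ 0 → θ p ≤ θ gp := by simpa [hm0] using hgp
  have l3 : ∀ n, star (m n) * w n ≠ 0 → θ gm ≤ θ n := by simpa [hm0] using hgm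
  have l4 : ∀ p, m p * x p ≠ 0 → θ p ≤ θ sp := by simpa [hm0] using hsp
  have c1 := corr_top hθ l1 l2
  have c2 := corr_top hθ l3 l4
  have hle1 : θ gp - θ sm ≤ θ sp - θ gm := by
    refine le_of_corr_ne_zero l3 l4 ?_
    rw [← h, c1]
    simp [hm0, hsm0, hgp0]
  have hle2 : θ sp - θ gm ≤ θ gp - θ sm := by
    refine le_of_corr_ne_zero l1 l2 ?_
    rw [h, c2]
    simp [hm0, hsp0, hgm0]
  rw [← le_antisymm hle1 hle2, ← h, c1] at c2
  have key : ∀ n, m n * star (m n) = 1 := fun n => by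
    rw [Complex.star_def, Complex.mul_conj, Complex.normSq_eq_norm_sq, hm]; simp
  unfold defect
  linear_combination (-(m sm * star (m gp))) * c2 + star (x sm) * v gp * (m gp * star (m gp) * key sm + key gp)

/-- The extreme points of a solution under two generic masks are those of the object. -/
lemma extreme_mem (hθ : Function.Injective θ) (hm : ∀ n, ‖m n‖ = 1) (hm' : ∀ n, ‖m' n‖ = 1)
    (hgen : ∀ e e' p q : κ, e ≠ e' → e ≠ p → e ≠ q → defect m e e' p q ≠ defect m' e e' p q)
    (h : PhaseSol θ m x v w) (h' : PhaseSol θ m' x v w) (hne : sp ≠ sm)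
    (hsp0 : x sp ≠ 0) (hsp : ∀ n, x n ≠ 0 → θ n ≤ θ sp)
    (hsm0 : x sm ≠ 0) (hsm : ∀ n, x n ≠ 0 → θ sm ≤ θ n)
    (hgp0 : v gp ≠ 0) (hgp : ∀ n, v n ≠ 0 → θ n ≤ θ gp)
    (hgm0 : w gm ≠ 0) (hgm : ∀ n, w n ≠ 0 → θ gm ≤ θ n) :
    (gp = sp ∧ gm = sm) ∨ (gp = sm ∧ gm = sp) := by
  have e1 := h.leading hθ hm hsp0 hsp hsm0 hsm hgp0 hgp hgm0 hgm
  have e2 := h'.leading hθ hm' hsp0 hsp hsm0 hsm hgp0 hgp hgm0 hgm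
  have heq : defect m sp sm gp gm = defect m' sp sm gp gm :=
    mul_right_cancel₀ (mul_ne_zero hgm0 hsp0) (e1.trans e2.symm)
  have hsymm : ∀ k : κ → ℂ, defect k sm sp gp gm = defect k sp sm gp gm := fun k => by
    unfold defect; ring
  have a1 : sp = gp ∨ sp = gm := by
    by_contra! hc
    exact hgen sp sm gp gm hne hc.1 hc.2 heq
  have a2 : sm = gp ∨ sm = gm := by
    by_contra! hc
    exact hgen sm sp gp gm hne.symm hc.1 hc.2 (by rw [hsymm, hsymm, heq])
  grind

/-- Uniqueness of the phase problem for two generic masks and an object which is supported on at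
least three points. -/
theorem eq_smul_of_phaseSol (hθ : Function.Injective θ) (hm : ∀ n, ‖m n‖ = 1)
    (hm' : ∀ n, ‖m' n‖ = 1)
    (hgen : ∀ e e' p q : κ, e ≠ e' → e ≠ p → e ≠ q → defect m e e' p q ≠ defect m' e e' p q)
    (hx : ∀ a b, ∃ q, x q ≠ 0 ∧ q ≠ a ∧ q ≠ b) {u : κ → ℂ}
    (h : PhaseSol θ m x u (fun n => -star (u n))) (h' : PhaseSol θ m' x u (fun n => -star (u n))) :
    ∃ ρ : ℂ, star ρ = -ρ ∧ ∀ n, u n = ρ * x n := by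
  by_cases hu : u = 0
  · exact ⟨0, by simp, by simp [hu]⟩
  have hx0 : x ≠ 0 := by
    rintro rfl
    obtain ⟨n, -⟩ := Function.ne_iff.1 hu
    obtain ⟨q, hq, -⟩ := hx n n
    exact hq rfl
  obtain ⟨sp, hsp0, hsp⟩ := exists_max_support hx0 θ
  obtain ⟨sm, hsm0, hsm⟩ := exists_min_support hx0 θ
  have hlt : θ sm < θ sp := by
    obtain ⟨q, hq, hq1, -⟩ := hx sp sp
    exact (hsm q hq).trans_lt (lt_of_le_of_ne (hsp q hq) (hθ.ne hq1))
  have hne : sp ≠ sm := fun h => by simp [h] at hlt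
  -- Here `u` and `-star u` have the same support, so the exchanged case would put the minimum above
  -- the maximum.
  have hsup : ∀ n, u n ≠ 0 → θ sm ≤ θ n ∧ θ n ≤ θ sp := by
    obtain ⟨gp, hgp0, hgp⟩ := exists_max_support hu θ
    obtain ⟨gm, hgm0, hgm⟩ := exists_min_support hu θ
    have hle := hgp gm hgm0
    rcases extreme_mem (gm := gm) hθ hm hm' hgen h h' hne hsp0 hsp hsm0 hsm hgp0 hgp
      (by simpa using hgm0) (by simpa using hgm) with ⟨rfl, rfl⟩ | ⟨rfl, rfl⟩
    · exact fun n hn => ⟨hgm n hn, hgp n hn⟩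
    · exact absurd hle (not_le.2 hlt)
  -- This choice makes `v` vanish at `sp`, which excludes the unexchanged case for `(v, w)`.
  set ρ := u sp / x sp with hρ
  have k := h.sub_smul ρ
  have k' := h'.sub_smul ρ
  set v : κ → ℂ := fun n => u n - ρ * x n with hv
  set w : κ → ℂ := fun n => -star (u n) - ρ * star (x n) with hw
  have hvsp : v sp = 0 := by simp [hv, hρ, hsp0]
  have hconj : star ρ = -ρ → ∀ n, w n = -star (v n) := fun hr n => by
    simp only [hv, hw, star_sub, star_mul', hr]; ring
  have hreal : ∀ q, x q ≠ 0 → v q = 0 → w q = 0 → star ρ = -ρ := fun q hq h1 h2 => by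
    have h3 : u q = ρ * x q := sub_eq_zero.1 h1
    simp only [hw, h3, star_mul'] at h2
    have : star (x q) ≠ 0 := star_ne_zero.2 hq
    exact mul_right_cancel₀ this (by linear_combination -h2)
  by_cases hv0 : v = 0
  · have hw0 : w = 0 := by
      by_contra hc
      exact (k.ne_zero_iff hθ hm hx0).2 hc hv0
    exact ⟨ρ, hreal sp hsp0 hvsp (congrFun hw0 sp), fun n => sub_eq_zero.1 (congrFun hv0 n)⟩
  · exfalso
    have hw0 := (k.ne_zero_iff hθ hm hx0).1 hv0
    obtain ⟨gp, hgp0, hgp⟩ := exists_max_support hv0 θ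
    obtain ⟨gm, hgm0, hgm⟩ := exists_min_support hw0 θ
    rcases extreme_mem hθ hm hm' hgen k k' hne hsp0 hsp hsm0 hsm hgp0 hgp hgm0 hgm with
      ⟨rfl, -⟩ | ⟨rfl, rfl⟩
    · exact hgp0 hvsp
    -- The maximum of `v` sits at the minimum of the object, so `v` lives on one point; likewise `w`
    -- on the opposite one. A third support point makes `ρ` imaginary, hence `w = -star v`, and the
    -- two different supports contradict each other.
    · have hvq : ∀ q, q ≠ gp → v q = 0 := fun q hq => by
        by_contra hc
        have h1 : θ gp ≤ θ q := by
          by_cases hxq : x q = 0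
          · exact (hsup q (by simpa [hv, hxq] using hc)).1
          · exact hsm q hxq
        exact hq (hθ (le_antisymm (hgp q hc) h1))
      have hwq : ∀ q, q ≠ gm → w q = 0 := fun q hq => by
        by_contra hc
        have h1 : θ q ≤ θ gm := by
          by_cases hxq : x q = 0
          · exact (hsup q (by simpa [hw, hxq] using hc)).2
          · exact hsp q hxq
        exact hq (hθ (le_antisymm h1 (hgm q hc)))
      obtain ⟨q, hq, hq1, hq2⟩ := hx gp gm
      have hr := hreal q hq (hvq q hq1) (hwq q hq2)
      have := hwq gp hne.symm
      rw [hconj hr] at this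
      exact hgp0 (by simpa using this)

end Uniqueness

/-! ### The second singular value of a contraction with a simple top. -/

section SingularValues

variable {E F : Type*} [NormedAddCommGroup E] [InnerProductSpace ℝ E] [FiniteDimensional ℝ E]
  [NormedAddCommGroup F] [InnerProductSpace ℝ F] [FiniteDimensional ℝ F] (T : E →ₗ[ℝ] F)

lemma norm_sq_apply_eq_sum {n : ℕ} (hn : Module.finrank ℝ E = n) (y : E) :
    ‖T y‖ ^ 2 = ∑ i : Fin n, T.singularValues i ^ 2 *
      (inner ℝ (T.isSymmetric_adjoint_comp_self.eigenvectorBasis hn i) y) ^ 2 := by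
  set b := T.isSymmetric_adjoint_comp_self.eigenvectorBasis hn with hb
  have h1 : ‖T y‖ ^ 2 = inner ℝ y ((T.adjoint ∘ₗ T) y) := by
    rw [LinearMap.comp_apply, LinearMap.adjoint_inner_right, real_inner_self_eq_norm_sq]
  rw [h1, ← b.sum_inner_mul_inner]
  refine Finset.sum_congr rfl fun i _ => ?_
  have h2 : inner ℝ (b i) ((T.adjoint ∘ₗ T) y) = T.singularValues i ^ 2 * inner ℝ (b i) y := by
    rw [← T.isSymmetric_adjoint_comp_self (b i) y, hb,
      T.isSymmetric_adjoint_comp_self.apply_eigenvectorBasis hn i, inner_smul_left,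
      T.sq_singularValues_fin hn]
    simp
  rw [h2, real_inner_comm]
  ring

variable {T} {e : F}

lemma norm_apply_le_of_adjoint (hle : ∀ u, ‖T.adjoint u‖ ≤ ‖u‖) (y : E) : ‖T y‖ ≤ ‖y‖ := by
  have h1 : ‖T y‖ ^ 2 ≤ ‖y‖ * ‖T y‖ := by
    rw [← real_inner_self_eq_norm_sq, ← LinearMap.adjoint_inner_right]
    exact (real_inner_le_norm _ _).trans (mul_le_mul_of_nonneg_left (hle _) (norm_nonneg _))
  nlinarith [norm_nonneg (T y), norm_nonneg y]

/-- If `T†` is a contraction which preserves the norm exactly on the line through `e`, then the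
second singular value of `T` is the norm of `T†` on the orthogonal complement of `e`. -/
theorem isGreatest_singularValues_one (hE : 2 ≤ Module.finrank ℝ E)
    (hF : 2 ≤ Module.finrank ℝ F) (he : ‖e‖ = 1) (hle : ∀ u, ‖T.adjoint u‖ ≤ ‖u‖)
    (hTe : ‖T.adjoint e‖ = 1) (huniq : ∀ u, ‖T.adjoint u‖ = ‖u‖ → ∃ r : ℝ, u = r • e) :
    IsGreatest {r : ℝ | ∃ u : F, u ≠ 0 ∧ inner ℝ u e = 0 ∧ r = ‖u‖⁻¹ * ‖T.adjoint u‖}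
      (T.singularValues 1) ∧ T.singularValues 1 < 1 := by
  obtain ⟨n, hn⟩ : ∃ n, Module.finrank ℝ E = n + 2 := ⟨_, (Nat.sub_add_cancel hE).symm⟩
  set b := T.isSymmetric_adjoint_comp_self.eigenvectorBasis hn with hb
  set f := T.adjoint e with hf
  have hbT : ∀ i : Fin (n + 2), T.adjoint (T (b i)) = (T.singularValues i ^ 2 : ℝ) • b i := by
    intro i
    have := T.isSymmetric_adjoint_comp_self.apply_eigenvectorBasis hn i
    rw [T.sq_singularValues_fin hn]
    exact this
  have hnorm : ∀ i : Fin (n + 2), ‖T (b i)‖ = T.singularValues i := by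
    intro i
    have h2 : ‖T (b i)‖ ^ 2 = T.singularValues i ^ 2 := by
      rw [← real_inner_self_eq_norm_sq, ← LinearMap.adjoint_inner_right, hbT, inner_smul_right,
        real_inner_self_eq_norm_sq, b.orthonormal.1]
      ring
    exact (sq_eq_sq₀ (norm_nonneg _) (T.singularValues_nonneg _)).1 h2
  -- Equality case of Cauchy-Schwarz: `⟪T f, e⟫ = 1` while both vectors have norm at most 1.
  have hTf : T f = e := by
    have h1 : inner ℝ (T f) e = 1 := by
      rw [← LinearMap.adjoint_inner_right, ← hf, real_inner_self_eq_norm_sq, hTe, one_pow]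
    have h2 := norm_apply_le_of_adjoint hle f
    rw [hTe] at h2
    have h3 := norm_sub_sq_real (T f) e
    rw [h1, he] at h3
    have h4 : ‖T f - e‖ = 0 := by nlinarith [norm_nonneg (T f), norm_nonneg (T f - e)]
    exact sub_eq_zero.1 (norm_eq_zero.1 h4)
  have hs0 : T.singularValues 0 = 1 := by
    have h1 : (1 : ℝ) ≤ T.singularValues 0 ^ 2 := by
      have h := norm_sq_apply_eq_sum T hn f
      rw [hTf, he, one_pow] at h
      have hb2 := b.sum_sq_inner_right f
      rw [hTe, one_pow] at hb2
      calc (1 : ℝ) = _ := h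
        _ ≤ ∑ i : Fin (n + 2), T.singularValues 0 ^ 2 * (inner ℝ (b i) f) ^ 2 := by
          refine Finset.sum_le_sum fun i _ => mul_le_mul_of_nonneg_right ?_ (sq_nonneg _)
          exact pow_le_pow_left₀ (T.singularValues_nonneg _)
            (T.singularValues_antitone (Nat.zero_le _)) 2
        _ = _ := by rw [← Finset.mul_sum, hb2, mul_one]
    have h2 : T.singularValues 0 ≤ 1 := by
      have := norm_apply_le_of_adjoint hle (b 0)
      rw [hnorm, b.orthonormal.1] at this
      exact this
    nlinarith [T.singularValues_nonneg 0]
  -- `T†` preserves the norm of `T (b 0)`, so uniqueness places that vector on the line of `e`;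
  -- applying `T†` gives the claim.
  obtain ⟨r, hr⟩ : ∃ r : ℝ, b 0 = r • f := by
    have h0 : T.adjoint (T (b 0)) = b 0 := by
      rw [hbT]; simp [hs0]
    obtain ⟨r, hr⟩ := huniq (T (b 0)) (by
      rw [h0, hnorm, b.orthonormal.1]; simp [hs0])
    exact ⟨r, by rw [← h0, hr, map_smul]⟩
  have hr0 : r ≠ 0 := by
    rintro rfl
    have := b.orthonormal.1 0
    rw [hr] at this
    simp at this
  have hb1f : inner ℝ (b 1) f = 0 := by
    have h : inner ℝ (b 1) (b 0) = 0 := b.orthonormal.2 (by simp)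
    rw [hr, inner_smul_right] at h
    exact (mul_eq_zero.1 h).resolve_left hr0
  have hs1 := T.singularValues_nonneg 1
  have hbound : ∀ y, inner ℝ f y = 0 → ‖T y‖ ≤ T.singularValues 1 * ‖y‖ := by
    intro y hy
    have hsq : ‖T y‖ ^ 2 ≤ (T.singularValues 1 * ‖y‖) ^ 2 := by
      rw [norm_sq_apply_eq_sum T hn y, mul_pow, ← b.sum_sq_inner_right y, Finset.mul_sum]
      refine Finset.sum_le_sum fun i _ => ?_
      rcases eq_or_ne i 0 with rfl | hi
      · rw [← hb, hr, inner_smul_left, hy]; simp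
      · refine mul_le_mul_of_nonneg_right ?_ (sq_nonneg _)
        refine pow_le_pow_left₀ (T.singularValues_nonneg _) (T.singularValues_antitone ?_) 2
        exact Nat.one_le_iff_ne_zero.2 fun h => hi (Fin.ext h)
    exact (sq_le_sq₀ (norm_nonneg _) (by positivity)).1 hsq
  -- `T†` maps `eᗮ` into `fᗮ`, where `T` is bounded by the second singular value; then `‖T† u‖² =
  -- ⟪u, T T† u⟫`.
  have hadj : ∀ u, inner ℝ u e = 0 → ‖T.adjoint u‖ ≤ T.singularValues 1 * ‖u‖ := by
    intro u hu
    have h1 : inner ℝ f (T.adjoint u) = 0 := by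
      rw [LinearMap.adjoint_inner_right, hTf, real_inner_comm, hu]
    have h2 := hbound _ h1
    have h3 : ‖T.adjoint u‖ ^ 2 ≤ ‖u‖ * ‖T (T.adjoint u)‖ := by
      rw [← real_inner_self_eq_norm_sq, LinearMap.adjoint_inner_right, real_inner_comm]
      exact real_inner_le_norm _ _
    by_contra! hlt
    have hpos : 0 < ‖T.adjoint u‖ := lt_of_le_of_lt (by positivity) hlt
    have h4 := h3.trans (mul_le_mul_of_nonneg_left h2 (norm_nonneg u))
    nlinarith
  have hgreat : IsGreatest {r : ℝ | ∃ u : F, u ≠ 0 ∧ inner ℝ u e = 0 ∧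
      r = ‖u‖⁻¹ * ‖T.adjoint u‖} (T.singularValues 1) := by
    constructor
    -- The natural maximizer `T (b 1)` vanishes when the singular value is 0; then any nonzero
    -- vector of `eᗮ` serves.
    · rcases hs1.eq_or_lt with h0 | hpos
      · obtain ⟨u, hu⟩ : ∃ u : (ℝ ∙ e)ᗮ, u ≠ 0 := by
          have hfr := Submodule.finrank_add_finrank_orthogonal (ℝ ∙ e)
          have h1 := finrank_span_singleton (K := ℝ) (v := e) (by rintro rfl; simp at he)
          have : Nontrivial (ℝ ∙ e)ᗮ := Module.nontrivial_of_finrank_pos (R := ℝ) (by omega)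
          exact exists_ne 0
        have hue : inner ℝ (u : F) e = 0 := by
          rw [real_inner_comm]
          exact Submodule.mem_orthogonal_singleton_iff_inner_right.1 u.2
        refine ⟨u, by simpa using hu, hue, ?_⟩
        have h2 := hadj u hue
        rw [← h0, zero_mul] at h2
        rw [← h0, le_antisymm h2 (norm_nonneg _), mul_zero]
      · refine ⟨T (b 1), ?_, ?_, ?_⟩
        · rw [← norm_pos_iff, hnorm]; simpa using hpos
        · rw [← LinearMap.adjoint_inner_right]; exact hb1f
        · rw [hbT, hnorm, norm_smul, b.orthonormal.1]
          simp only [Fin.val_one, mul_one, norm_pow, Real.norm_eq_abs, abs_of_pos hpos]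
          field_simp
    · rintro _ ⟨u, hu, hue, rfl⟩
      have := hadj u hue
      rw [inv_mul_le_iff₀ (norm_pos_iff.2 hu), mul_comm]
      exact this
  refine ⟨hgreat, ?_⟩
  obtain ⟨u, hu, hue, hval⟩ := hgreat.1
  have hupos := norm_pos_iff.2 hu
  rw [hval, inv_mul_lt_iff₀ hupos, mul_one]
  refine lt_of_le_of_ne (hle u) fun heq => ?_
  obtain ⟨r, rfl⟩ := huniq u heq
  rw [inner_smul_left, real_inner_self_eq_norm_sq, he] at hue
  apply hu
  simp at hue
  simp [hue]

end SingularValues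

/-! ### From oversampled Fourier data to correlation coefficients. -/

section Fourier

variable {d : ℕ} (M : Fin d → ℕ)

/-- The mixed radix expansion, an injection of the object grid into `ℤ`. -/
def gridIndex (n : ObjGrid M) : ℤ :=
  ((finPiFinEquiv n : ℕ) : ℤ)

lemma gridIndex_injective : Function.Injective (gridIndex M) := fun a b h => by
  simpa [gridIndex, Fin.val_inj] using h

/-- The difference of two grid points. -/
def gridDiff (n p : ObjGrid M) (i : Fin d) : ℤ := (p i : ℕ) - (n i : ℕ)

lemma gridIndex_sub_gridIndex {n p n' p' : ObjGrid M} (h : gridDiff M n p = gridDiff M n' p') :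
    gridIndex M p - gridIndex M n = gridIndex M p' - gridIndex M n' := by
  simp only [gridIndex, finPiFinEquiv_apply, Nat.cast_sum, Nat.cast_mul,
    ← Finset.sum_sub_distrib, ← sub_mul]
  exact Finset.sum_congr rfl fun i _ => congrArg (· * _) (congrFun h i)

lemma oversampledDFT_eq_prod (k : FreqGrid M) (n : ObjGrid M) :
    oversampledDFT M k n = ∏ i, (Complex.exp (2 * Real.pi * Complex.I / (2 * M i + 1 : ℕ))) ^
      (-((n i : ℕ) * (k i : ℕ) : ℤ)) := by
  simp only [oversampledDFT, Matrix.of_apply, Finset.mul_sum, ← Finset.sum_neg_distrib,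
    Complex.exp_sum, ← Complex.exp_int_mul]
  refine Finset.prod_congr rfl fun i _ => ?_
  congr 1
  push_cast
  ring

lemma sum_pow_primitiveRoot_zpow {N : ℕ} {ζ : ℂ} (hζ : IsPrimitiveRoot ζ N) (j : ℤ) :
    ∑ k : Fin N, (ζ ^ j) ^ (k : ℕ) = if (N : ℤ) ∣ j then (N : ℂ) else 0 := by
  rw [Fin.sum_univ_eq_sum_range (fun k => (ζ ^ j) ^ k) N]
  split_ifs with h
  · simp [(hζ.zpow_eq_one_iff_dvd j).2 h]
  · have h1 : ζ ^ j ≠ 1 := fun h' => h ((hζ.zpow_eq_one_iff_dvd j).1 h')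
    rw [geom_sum_eq h1, ← zpow_natCast, ← zpow_mul, mul_comm, zpow_mul, zpow_natCast, hζ.pow_eq_one]
    simp

lemma sum_oversampledDFT (n p n₀ p₀ : ObjGrid M) :
    ∑ k, oversampledDFT M k n₀ * star (oversampledDFT M k p₀) *
      (star (oversampledDFT M k n) * oversampledDFT M k p) =
      if gridDiff M n p = gridDiff M n₀ p₀ then (∏ i, (2 * M i + 1 : ℕ) : ℂ) else 0 := by
  have hζ := fun i => Complex.isPrimitiveRoot_exp (2 * M i + 1) (Nat.succ_ne_zero _)
  set ζ : Fin d → ℂ := fun i => Complex.exp (2 * Real.pi * Complex.I / (2 * M i + 1 : ℕ)) with hζdef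
  have hζ0 : ∀ i, ζ i ≠ 0 := fun i => Complex.exp_ne_zero _
  have hstar : ∀ i, star (ζ i) = (ζ i)⁻¹ := fun i => by
    rw [hζdef, ← Complex.exp_neg, Complex.star_def, ← Complex.exp_conj]
    congr 1
    simp [neg_div, map_ofNat (starRingEnd ℂ) 2]
  have hterm : ∀ k : FreqGrid M, oversampledDFT M k n₀ * star (oversampledDFT M k p₀) *
      (star (oversampledDFT M k n) * oversampledDFT M k p) =
      ∏ i, (ζ i ^ (gridDiff M n₀ p₀ i - gridDiff M n p i)) ^ (k i : ℕ) := by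
    intro k
    simp only [oversampledDFT_eq_prod, star_prod, star_zpow₀, ← Finset.prod_mul_distrib]
    refine Finset.prod_congr rfl fun i _ => ?_
    change ζ i ^ _ * star (ζ i) ^ _ * (star (ζ i) ^ _ * ζ i ^ _) = _
    rw [hstar, inv_zpow', inv_zpow', ← zpow_add₀ (hζ0 i), ← zpow_add₀ (hζ0 i),
      ← zpow_add₀ (hζ0 i), ← zpow_natCast, ← zpow_mul]
    congr 1
    simp only [gridDiff]
    ring
  simp only [hterm]
  rw [← Fintype.piFinset_univ, ← Finset.prod_univ_sum (fun _ => Finset.univ)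
    (fun i (k : Fin (2 * M i + 1)) =>
      (ζ i ^ (gridDiff M n₀ p₀ i - gridDiff M n p i)) ^ (k : ℕ))]
  have hgeom : ∀ i, ∑ k : Fin (2 * M i + 1),
      (ζ i ^ (gridDiff M n₀ p₀ i - gridDiff M n p i)) ^ (k : ℕ) = _ :=
    fun i => sum_pow_primitiveRoot_zpow (hζ i) _
  simp only [hgeom]
  split_ifs with h
  · refine Finset.prod_congr rfl fun i _ => ?_
    rw [if_pos (by simp [h])]
  · obtain ⟨i, hi⟩ := Function.ne_iff.1 h
    refine Finset.prod_eq_zero (Finset.mem_univ i) (if_neg fun hdvd => hi ?_)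
    have h1 := (n i).2
    have h2 := (p i).2
    have h3 := (n₀ i).2
    have h4 := (p₀ i).2
    -- Each difference lies in `[-M i, M i]`, so two of them differ by at most `2 * M i`, less than
    -- the modulus: there is no aliasing.
    have := Int.eq_zero_of_abs_lt_dvd hdvd (by
      rw [abs_lt]
      simp only [gridDiff]
      constructor <;> push_cast <;> omega)
    omega

/-- The oversampled Fourier transform determines the coefficients of an autocorrelation. -/
lemma sum_gridIndex_eq_zero {K : ObjGrid M → ObjGrid M → ℂ}
    (hK : ∀ k, ∑ n, ∑ p, star (oversampledDFT M k n) * oversampledDFT M k p * K n p = 0) (t : ℤ) :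
    (∑ n, ∑ p, if gridIndex M p - gridIndex M n = t then K n p else 0) = 0 := by
  have h1 : ∀ n₀ p₀ : ObjGrid M,
      ∑ q : ObjGrid M × ObjGrid M,
        (if gridDiff M q.1 q.2 = gridDiff M n₀ p₀ then K q.1 q.2 else 0) = 0 := by
    intro n₀ p₀
    have hN : (∏ i, (2 * M i + 1 : ℕ) : ℂ) ≠ 0 :=
      Finset.prod_ne_zero_iff.2 fun i _ => Nat.cast_ne_zero.2 (Nat.succ_ne_zero _)
    refine (mul_eq_zero.1 ?_).resolve_left hN
    calc _ = ∑ q : ObjGrid M × ObjGrid M, ∑ k, oversampledDFT M k n₀ *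
          star (oversampledDFT M k p₀) *
          (star (oversampledDFT M k q.1) * oversampledDFT M k q.2) * K q.1 q.2 := by
            rw [Finset.mul_sum]
            refine Finset.sum_congr rfl fun q _ => ?_
            rw [← Finset.sum_mul, sum_oversampledDFT]
            split_ifs <;> simp
      _ = ∑ k, oversampledDFT M k n₀ * star (oversampledDFT M k p₀) *
          ∑ n, ∑ p, star (oversampledDFT M k n) * oversampledDFT M k p * K n p := by
            rw [Finset.sum_comm]
            refine Finset.sum_congr rfl fun k _ => ?_
            rw [← Fintype.sum_prod_type', Finset.mul_sum]
            exact Finset.sum_congr rfl fun q _ => by ring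
      _ = 0 := Finset.sum_eq_zero fun k _ => by rw [hK, mul_zero]
  -- Different grid differences may share one index difference `t`, but each fiber of `gridDiff`
  -- lies wholly inside or outside the sum, and its total is zero.
  rw [← Fintype.sum_prod_type' (f := fun n p : ObjGrid M =>
      if gridIndex M p - gridIndex M n = t then K n p else 0),
    ← Finset.sum_fiberwise_of_maps_to (g := fun q : ObjGrid M × ObjGrid M => gridDiff M q.1 q.2)
      (t := Finset.univ.image fun q : ObjGrid M × ObjGrid M => gridDiff M q.1 q.2)
      (fun q _ => Finset.mem_image_of_mem _ (Finset.mem_univ q))]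
  refine Finset.sum_eq_zero fun m hm => ?_
  obtain ⟨q₀, -, rfl⟩ := Finset.mem_image.1 hm
  by_cases ht : gridIndex M q₀.2 - gridIndex M q₀.1 = t
  · rw [← h1 q₀.1 q₀.2, Finset.sum_filter]
    refine Finset.sum_congr rfl fun q _ => ?_
    split_ifs with h2 h3
    · rfl
    · exact absurd ((gridIndex_sub_gridIndex M h2).trans ht) h3
    · rfl
  · refine Finset.sum_eq_zero fun q hq => if_neg fun h => ht ?_
    rw [← h]
    exact (gridIndex_sub_gridIndex M (Finset.mem_filter.1 hq).2).symm

lemma propagation_mulVec_apply {ℓ : ℕ} (c : ℂ) (μ : Fin ℓ → ObjGrid M → ℂ) (x : ObjGrid M → ℂ)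
    (j : Fin ℓ) (k : FreqGrid M) :
    (propagation M c μ *ᵥ x) (j, k) = c * ∑ n, oversampledDFT M k n * (μ j n * x n) := by
  simp only [Matrix.mulVec, dotProduct, propagation, Matrix.of_apply, Matrix.mul_diagonal,
    Finset.mul_sum]
  exact Finset.sum_congr rfl fun n _ => by ring

lemma phaseSol_of_re_eq_zero {ℓ : ℕ} {c : ℂ} (hc : c ≠ 0) (μ : Fin ℓ → ObjGrid M → ℂ)
    (x u : ObjGrid M → ℂ)
    (h : ∀ q, (star ((propagation M c μ *ᵥ x) q) * (propagation M c μ *ᵥ u) q).re = 0)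
    (j : Fin ℓ) : PhaseSol (gridIndex M) (μ j) x u (fun n => -star (u n)) := by
  have hK := sum_gridIndex_eq_zero M
    (K := fun n p => star (μ j n) * star (x n) * (μ j p * u p) -
      star (μ j n) * -star (u n) * (μ j p * x p)) (fun k => by
    have hk := h (j, k)
    rw [propagation_mulVec_apply, propagation_mulVec_apply] at hk
    set X := ∑ n, oversampledDFT M k n * (μ j n * x n) with hX
    set U := ∑ n, oversampledDFT M k n * (μ j n * u n) with hU
    have h2 : star (c * X) * (c * U) + star (star (c * X) * (c * U)) = 0 := by
      set z := star (c * X) * (c * U)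
      rw [Complex.star_def, Complex.add_conj, hk]
      simp
    have h3 : (star c * c) * (star X * U + star U * X) = 0 := by
      rw [← h2]
      simp only [star_mul', star_star]
      ring
    have h4 := (mul_eq_zero.1 h3).resolve_left (mul_ne_zero (star_ne_zero.2 hc) hc)
    rw [← h4, hX, hU]
    simp only [star_sum, Finset.sum_mul_sum, ← Finset.sum_add_distrib]
    refine Finset.sum_congr rfl fun n _ => Finset.sum_congr rfl fun p _ => ?_
    simp only [star_mul']
    ring)
  intro t
  rw [← sub_eq_zero, ← hK t]
  simp only [corr, ← Finset.sum_sub_distrib]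
  refine Finset.sum_congr rfl fun n _ => Finset.sum_congr rfl fun p _ => ?_
  split_ifs <;> ring

/-- A support of at most two points is collinear, and taking the convex hull does not change the
affine span. -/
lemma exists_mem_support_ne {M : Fin d → ℕ} {x : EuclideanSpace ℂ (ObjGrid M)} (hx : 2 ≤ objectRank x)
    (a b : ObjGrid M) : ∃ q, x q ≠ 0 ∧ q ≠ a ∧ q ≠ b := by
  by_contra! hc
  let φ : ObjGrid M → Fin d → ℝ := fun n i => ((n i : ℕ) : ℝ)
  have hsub : φ '' {n | x n ≠ 0} ⊆ {φ a, φ b} := by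
    rintro _ ⟨n, hn, rfl⟩
    by_cases h : n = a
    · exact Or.inl (by rw [h])
    · exact Or.inr (by rw [hc n hn h]; rfl)
  have hcol := (collinear_pair ℝ (φ a) (φ b)).subset hsub
  have hle := collinear_iff_finrank_le_one.1 hcol
  have : objectRank x = Module.finrank ℝ (vectorSpan ℝ (φ '' {n | x n ≠ 0})) := by
    unfold objectRank
    rw [← direction_affineSpan, affineSpan_convexHull, direction_affineSpan]
  omega

end Fourier

/-! ### The real form of `B` and the spectral gap. -/

section RealForm

lemma norm_phase {ι : Type*} (y : ι → ℂ) (j : ι) : ‖phase y j‖ = 1 := by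
  unfold phase
  split_ifs with h <;> simp [h]

lemma norm_mul_phase {ι : Type*} (y : ι → ℂ) (j : ι) : (‖y j‖ : ℂ) * phase y j = y j := by
  unfold phase
  split_ifs with h
  · simp [h]
  · have : (‖y j‖ : ℂ) ≠ 0 := by simpa using h
    field_simp

lemma star_dotProduct_self {ι : Type*} [Fintype ι] (z : ι → ℂ) :
    star z ⬝ᵥ z = ((∑ j, ‖z j‖ ^ 2 : ℝ) : ℂ) := by
  simp only [dotProduct, Pi.star_apply, Complex.ofReal_sum]
  refine Finset.sum_congr rfl fun j _ => ?_
  rw [mul_comm, Complex.star_def, Complex.mul_conj, Complex.normSq_eq_norm_sq]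

variable {ι κ : Type*} [Fintype κ] [Fintype ι]

lemma norm_mulVec_of_isometric [DecidableEq κ] {A : Matrix ι κ ℂ} (hA : Aᴴ * A = 1)
    (u : EuclideanSpace ℂ κ) : ∑ j, ‖(A *ᵥ u.ofLp) j‖ ^ 2 = ‖u‖ ^ 2 := by
  have h : star (A *ᵥ u.ofLp) ⬝ᵥ (A *ᵥ u.ofLp) = star u.ofLp ⬝ᵥ u.ofLp := by
    rw [Matrix.star_mulVec, Matrix.dotProduct_mulVec, Matrix.vecMul_vecMul, hA, Matrix.vecMul_one]
  rw [EuclideanSpace.norm_sq_eq]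
  have e1 := star_dotProduct_self (A *ᵥ u.ofLp)
  have e2 := star_dotProduct_self u.ofLp
  rw [h, e2] at e1
  exact_mod_cast e1.symm

variable [DecidableEq ι] (A : Matrix ι κ ℂ) (x u : EuclideanSpace ℂ κ)

lemma conjTranspose_matB_mulVec (j : ι) :
    ((matB A x)ᴴ *ᵥ u.ofLp) j = star (phase (A *ᵥ x.ofLp) j) * (A *ᵥ u.ofLp) j := by
  rw [matB, Matrix.conjTranspose_mul, Matrix.conjTranspose_conjTranspose,
    Matrix.diagonal_conjTranspose, ← Matrix.mulVec_mulVec, Matrix.mulVec_diagonal]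
  rfl

lemma norm_sq_imBstar_add [DecidableEq κ] {A : Matrix ι κ ℂ} (hA : Aᴴ * A = 1) :
    ‖imBstar (matB A x) u‖ ^ 2 + ∑ j, (((matB A x)ᴴ *ᵥ u.ofLp) j).re ^ 2 = ‖u‖ ^ 2 := by
  rw [← norm_mulVec_of_isometric hA u, EuclideanSpace.norm_sq_eq, ← Finset.sum_add_distrib]
  refine Finset.sum_congr rfl fun j _ => ?_
  have h1 : ‖((matB A x)ᴴ *ᵥ u.ofLp) j‖ = ‖(A *ᵥ u.ofLp) j‖ := by
    rw [conjTranspose_matB_mulVec, norm_mul, norm_star, norm_phase, one_mul]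
  rw [← h1, ← Complex.normSq_eq_norm_sq, Complex.normSq_apply]
  simp only [imBstar, Real.norm_eq_abs, sq_abs]
  ring

lemma norm_imBstar_le [DecidableEq κ] {A : Matrix ι κ ℂ} (hA : Aᴴ * A = 1) :
    ‖imBstar (matB A x) u‖ ≤ ‖u‖ := by
  refine (sq_le_sq₀ (norm_nonneg _) (norm_nonneg _)).1 ?_
  rw [← norm_sq_imBstar_add x u hA]
  exact le_add_of_nonneg_right (Finset.sum_nonneg fun j _ => sq_nonneg _)

/-- The real part of `B^* u` vanishes by Pythagoras; multiplying by `|A^* x|` removes the phases, so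
their default value at zeros is harmless. -/
lemma re_eq_zero_of_norm_imBstar_eq [DecidableEq κ] {A : Matrix ι κ ℂ} (hA : Aᴴ * A = 1)
    (h : ‖imBstar (matB A x) u‖ = ‖u‖) (j : ι) :
    (star ((A *ᵥ x.ofLp) j) * (A *ᵥ u.ofLp) j).re = 0 := by
  have h0 := norm_sq_imBstar_add x u hA
  rw [h] at h0
  have h1 := (Finset.sum_eq_zero_iff_of_nonneg fun j _ => sq_nonneg _).1
    (add_eq_left.1 h0) j (Finset.mem_univ j)
  have h2 := pow_eq_zero_iff two_ne_zero |>.1 h1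
  rw [conjTranspose_matB_mulVec] at h2
  have hreal : ∀ r : ℝ, star (r : ℂ) = r := Complex.conj_ofReal
  rw [← norm_mul_phase (A *ᵥ x.ofLp) j, star_mul', mul_assoc, hreal, Complex.re_ofReal_mul, h2,
    mul_zero]

/-- `B^* (a x) = a |A^* x|` is purely imaginary, so its real part contributes nothing. -/
lemma norm_imBstar_smul_self [DecidableEq κ] {A : Matrix ι κ ℂ} (hA : Aᴴ * A = 1) {a : ℂ}
    (ha : a.re = 0) : ‖imBstar (matB A x) (a • x)‖ = ‖a • x‖ := by
  refine (sq_eq_sq₀ (norm_nonneg _) (norm_nonneg _)).1 ?_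
  rw [← norm_sq_imBstar_add x (a • x) hA, left_eq_add]
  refine Finset.sum_eq_zero fun j _ => ?_
  rw [conjTranspose_matB_mulVec, WithLp.ofLp_smul, Matrix.mulVec_smul, Pi.smul_apply,
    ← norm_mul_phase (A *ᵥ x.ofLp) j, smul_eq_mul]
  set w := phase (A *ᵥ x.ofLp) j
  have hw : star w * w = 1 := by
    rw [mul_comm, Complex.star_def, Complex.mul_conj, Complex.normSq_eq_norm_sq, norm_phase]
    simp
  have : star w * (a * ((‖(A *ᵥ x.ofLp) j‖ : ℂ) * w)) = (‖(A *ᵥ x.ofLp) j‖ : ℂ) * a := by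
    linear_combination (‖(A *ᵥ x.ofLp) j‖ : ℂ) * a * hw
  rw [this, Complex.re_ofReal_mul, ha]
  simp

/-- The real coordinates `(Im u, -Re u)` of a complex vector. -/
def realCoord {κ : Type*} (u : EuclideanSpace ℂ κ) : EuclideanSpace ℝ (κ ⊕ κ) :=
  WithLp.toLp 2 (Sum.elim (fun k => (u k).im) fun k => -(u k).re)

lemma realCoord_surjective {κ : Type*} : Function.Surjective (realCoord (κ := κ)) := fun z => by
  refine ⟨WithLp.toLp 2 fun k => ⟨-z (.inr k), z (.inl k)⟩, ?_⟩
  ext (k | k) <;> simp [realCoord]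

lemma realCoord_smul {κ : Type*} (r : ℝ) (u : EuclideanSpace ℂ κ) :
    realCoord ((r : ℂ) • u) = r • realCoord u := by
  ext (k | k) <;> simp [realCoord]

lemma inner_realCoord (u v : EuclideanSpace ℂ κ) :
    inner ℝ (realCoord u) (realCoord v) = (inner ℂ u v).re := by
  simp only [PiLp.inner_apply, Fintype.sum_sum_type, realCoord, Complex.re_sum,
    ← Finset.sum_add_distrib]
  refine Finset.sum_congr rfl fun k _ => ?_
  simp
  ring

lemma norm_realCoord (u : EuclideanSpace ℂ κ) : ‖realCoord u‖ = ‖u‖ := by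
  refine (sq_eq_sq₀ (norm_nonneg _) (norm_nonneg _)).1 ?_
  rw [← real_inner_self_eq_norm_sq, inner_realCoord, ← inner_self_eq_norm_sq (𝕜 := ℂ) u]
  rfl

/-- `Im (conj b * u) = Re b * Im u - Im b * Re u`, which dictates the order and the sign in
`realCoord`. -/
lemma adjoint_realForm_realCoord [DecidableEq κ] (B : Matrix κ ι ℂ) :
    (Matrix.toEuclideanLin (realForm B)).adjoint (realCoord u) = imBstar B u := by
  rw [← Matrix.toEuclideanLin_conjTranspose_eq_adjoint]
  ext j
  simp only [Matrix.toLpLin_apply, imBstar, realCoord, Matrix.mulVec, dotProduct,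
    Fintype.sum_sum_type, Matrix.conjTranspose_apply, realForm, Complex.im_sum,
    ← Finset.sum_add_distrib]
  refine Finset.sum_congr rfl fun k _ => ?_
  simp

/-- If the phase equations determine the object up to a real factor, then `i x₀ / ‖x₀‖` is the only
maximizer of `‖Im (B^* u)‖` up to the sign, and there is a spectral gap. -/
theorem spectral_gap [DecidableEq κ] {A : Matrix ι κ ℂ} (hA : Aᴴ * A = 1) (hι : 2 ≤ Fintype.card ι)
    {x : EuclideanSpace ℂ κ} (hx : x ≠ 0)
    (huniq : ∀ u : EuclideanSpace ℂ κ,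
      (∀ j, (star ((A *ᵥ x.ofLp) j) * (A *ᵥ u.ofLp) j).re = 0) →
        ∃ ρ : ℂ, star ρ = -ρ ∧ ∀ n, u n = ρ * x n) :
    (∀ u : EuclideanSpace ℂ κ, (‖imBstar (matB A x) u‖ = 1 ∧ ‖u‖ = 1) ↔
      (u = (Complex.I / (‖x‖ : ℂ)) • x ∨ u = -((Complex.I / (‖x‖ : ℂ)) • x))) ∧
    IsGreatest {r : ℝ | ∃ u : EuclideanSpace ℂ κ, u ≠ 0 ∧
      (inner ℂ u (Complex.I • x)).re = 0 ∧ r = ‖u‖⁻¹ * ‖imBstar (matB A x) u‖}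
      (lambdaTwo (matB A x)) ∧
    lambdaTwo (matB A x) < 1 := by
  have hx0 : ‖x‖ ≠ 0 := norm_ne_zero_iff.2 hx
  have hxC : (‖x‖ : ℂ) ≠ 0 := Complex.ofReal_ne_zero.2 hx0
  set e := (Complex.I / (‖x‖ : ℂ)) • x with he
  have hre : (Complex.I / (‖x‖ : ℂ)).re = 0 := by simp [Complex.div_ofReal_re]
  have hen : ‖e‖ = 1 := by
    rw [he, norm_smul, norm_div, Complex.norm_I, Complex.norm_real, norm_norm,
      one_div, inv_mul_cancel₀ hx0]
  have hBe : ‖imBstar (matB A x) e‖ = 1 := by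
    rw [← hen]; exact norm_imBstar_smul_self x hA hre
  have hline : ∀ u, ‖imBstar (matB A x) u‖ = ‖u‖ → ∃ r : ℝ, u = (r : ℂ) • e := by
    intro u hu
    obtain ⟨ρ, hρ, hux⟩ := huniq u (re_eq_zero_of_norm_imBstar_eq x u hA hu)
    have hρ0 : ρ.re = 0 := by
      have := congrArg Complex.re hρ
      simp at this
      linarith
    have hρ' : ρ = ρ.im * Complex.I := by
      apply Complex.ext <;> simp [hρ0]
    refine ⟨ρ.im * ‖x‖, ?_⟩
    ext n
    rw [hux n, he]
    simp only [PiLp.smul_apply, smul_eq_mul]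
    push_cast
    conv_lhs => rw [hρ']
    field_simp
  have hneg : imBstar (matB A x) (-e) = -imBstar (matB A x) e := by
    ext j
    simp [imBstar, Matrix.mulVec_neg]
  obtain ⟨n₀, -⟩ : ∃ n, x n ≠ 0 := by
    by_contra! h
    exact hx (by ext n; exact h n)
  have hgap := isGreatest_singularValues_one (T := Matrix.toEuclideanLin (realForm (matB A x)))
    (e := realCoord e) (by simpa using hι) (by
      have : 0 < Fintype.card κ := Fintype.card_pos_iff.2 ⟨n₀⟩
      simp only [finrank_euclideanSpace, Fintype.card_sum]
      omega)
    (by rw [norm_realCoord, hen])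
    (fun z => by
      obtain ⟨u, rfl⟩ := realCoord_surjective z
      rw [adjoint_realForm_realCoord, norm_realCoord]
      exact norm_imBstar_le x u hA)
    (by rw [adjoint_realForm_realCoord, hBe])
    (fun z hz => by
      obtain ⟨u, rfl⟩ := realCoord_surjective z
      rw [adjoint_realForm_realCoord, norm_realCoord] at hz
      obtain ⟨r, rfl⟩ := hline u hz
      exact ⟨r, realCoord_smul r e⟩)
  refine ⟨fun u => ⟨fun ⟨h1, h2⟩ => ?_, ?_⟩, ?_, hgap.2⟩
  · obtain ⟨r, rfl⟩ := hline u (h1.trans h2.symm)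
    rw [norm_smul, hen, mul_one, Complex.norm_real, Real.norm_eq_abs] at h2
    rcases (abs_eq zero_le_one).1 h2 with rfl | rfl
    · left; simp
    · right; simp
  · rintro (rfl | rfl)
    · exact ⟨hBe, hen⟩
    · rw [hneg, norm_neg, norm_neg]
      exact ⟨hBe, hen⟩
  · convert hgap.1 using 1
    swap
    · rfl
    ext r
    have horth : ∀ u, (inner ℂ u (Complex.I • x)).re = 0 ↔
        inner ℝ (realCoord u) (realCoord e) = 0 := fun u => by
      have : e = ((‖x‖⁻¹ : ℝ) : ℂ) • (Complex.I • x) := by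
        rw [he, smul_smul]
        congr 1
        push_cast
        field_simp
      rw [this, realCoord_smul, real_inner_smul_right, inner_realCoord, mul_eq_zero,
        or_iff_right (inv_ne_zero hx0)]
    constructor
    · rintro ⟨u, hu, hux, rfl⟩
      refine ⟨realCoord u, ?_, (horth u).1 hux, ?_⟩
      · rwa [← norm_ne_zero_iff, norm_realCoord, norm_ne_zero_iff]
      · rw [norm_realCoord, adjoint_realForm_realCoord]
    · rintro ⟨z, hz, hze, rfl⟩
      obtain ⟨u, rfl⟩ := realCoord_surjective z
      refine ⟨u, ?_, (horth u).2 hze, ?_⟩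
      · rwa [← norm_ne_zero_iff, norm_realCoord, norm_ne_zero_iff] at hz
      · rw [norm_realCoord, adjoint_realForm_realCoord]

end RealForm

end CodedDiffraction

/-! ### The almost sure statement. -/

theorem mainTheorem2 {d ℓ : ℕ} (hℓ : 2 ≤ ℓ) (M : Fin d → ℕ)
    {Ω : Type*} [MeasurableSpace Ω] (P : Measure Ω) [IsProbabilityMeasure P]
    -- the phase masks: each is random or deterministic, with values on the unit circle
    (μ : Fin ℓ → Ω → CodedDiffraction.ObjGrid M → ℂ)
    (hμ_meas : ∀ j n, Measurable fun ω => μ j ω n)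
    (hμ_unit : ∀ j n, ∀ᵐ ω ∂P, ‖μ j ω n‖ = 1)
    -- one mask has independent, continuously distributed entries and is independent of the others
    (j₀ : Fin ℓ)
    (hμ_indep : iIndepFun (fun n ω => μ j₀ ω n) P)
    (hμ_cont : ∀ n z, P {ω | μ j₀ ω n = z} = 0)
    (hμ_masks : ∀ j, j ≠ j₀ → IndepFun (μ j₀) (μ j) P)
    -- the propagation matrix is isometric
    (c : ℂ)
    (hA : ∀ᵐ ω ∂P, (CodedDiffraction.propagation M c fun j => μ j ω)ᴴ *
      (CodedDiffraction.propagation M c fun j => μ j ω) = 1)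
    (x₀ : EuclideanSpace ℂ (CodedDiffraction.ObjGrid M))
    (hx₀ : 2 ≤ CodedDiffraction.objectRank x₀) :
    ∀ᵐ ω ∂P,
      let B := CodedDiffraction.matB (CodedDiffraction.propagation M c fun j => μ j ω) x₀
      (∀ u : EuclideanSpace ℂ (CodedDiffraction.ObjGrid M),
        (‖CodedDiffraction.imBstar B u‖ = 1 ∧ ‖u‖ = 1) ↔
          (u = (Complex.I / (‖x₀‖ : ℂ)) • x₀ ∨ u = -((Complex.I / (‖x₀‖ : ℂ)) • x₀))) ∧
      IsGreatest
        {r : ℝ | ∃ u : EuclideanSpace ℂ (CodedDiffraction.ObjGrid M), u ≠ 0 ∧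
          (inner ℂ u (Complex.I • x₀)).re = 0 ∧ r = ‖u‖⁻¹ * ‖CodedDiffraction.imBstar B u‖}
        (CodedDiffraction.lambdaTwo B) ∧
      CodedDiffraction.lambdaTwo B < 1 := by
  obtain ⟨j₁, hj₁⟩ : ∃ j : Fin ℓ, j ≠ j₀ := by
    have : Nontrivial (Fin ℓ) := Fin.nontrivial_iff_two_le.2 hℓ
    exact exists_ne j₀
  have hgen := CodedDiffraction.ae_defect_ne (hμ_meas j₀) (hμ_meas j₁) (hμ_unit j₀) hμ_indep
    hμ_cont (hμ_masks j₁ hj₁)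
  have hunit₀ : ∀ᵐ ω ∂P, ∀ n, ‖μ j₀ ω n‖ = 1 := ae_all_iff.2 (hμ_unit j₀)
  have hunit₁ : ∀ᵐ ω ∂P, ∀ n, ‖μ j₁ ω n‖ = 1 := ae_all_iff.2 (hμ_unit j₁)
  have hsupp := CodedDiffraction.exists_mem_support_ne hx₀
  have hx : x₀ ≠ 0 := by
    rintro rfl
    obtain ⟨q, hq, -⟩ := hsupp (fun _ => 0) (fun _ => 0)
    exact hq rfl
  filter_upwards [hgen, hunit₀, hunit₁, hA] with ω hgen h₀ h₁ hA
  have hc : c ≠ 0 := by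
    rintro rfl
    have h0 : CodedDiffraction.propagation M 0 (fun j => μ j ω) = 0 := by
      ext q n
      simp [CodedDiffraction.propagation]
    rw [h0, Matrix.mul_zero] at hA
    exact zero_ne_one hA
  refine CodedDiffraction.spectral_gap hA ?_ hx fun u hu => ?_
  · have : 0 < Fintype.card (CodedDiffraction.FreqGrid M) := Fintype.card_pos
    rw [Fintype.card_prod, Fintype.card_fin]
    nlinarith
  · have hsol := CodedDiffraction.phaseSol_of_re_eq_zero M hc (fun j => μ j ω) x₀.ofLp u.ofLp hu
    exact CodedDiffraction.eq_smul_of_phaseSol (CodedDiffraction.gridIndex_injective M) h₀ h₁ hgen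
      hsupp (hsol j₀) (hsol j₁)
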